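/- Let $p$ be a prime and $P$ a finite $p$-group. A fusion system $\mathcal F$ on $P$ consists of a set $\operatorname{Hom}_{\mathcal F}(Q,R)$ of injective homomorphisms $Q\to R$ for all subgroups $Q,R\le P$, closed under composition, containing every conjugation map $x\mapsto g^{-1}xg$ from $Q$ to $R$ with $g\in P$ and $Q^g\le R$, and closed under replacing $\phi:Q\to R$ by the isomorphism $Q\to Q\phi$ and under inverting isomorphisms. A subgroup $R\le P$ is weakly $\mathcal F$-closed if it is the only subgroup of $P$ that is $\mathcal F$-isomorphic to $R$, and strongly $\mathcal F$-closed if every morphism in $\mathcal F$ whose domain is a subgroup of $R$ has its image contained in $R$. The system $\mathcal F$ is saturated if $\operatorname{Aut}_P(P)$ is a Sylow $p$-subgroup of $\operatorname{Aut}_{\mathcal F}(P)$, and every morphism $\phi:R\to P$ in $\mathcal F$ whose image is fully normalized (that is, $|N_P(R\phi)|\ge|N_P(S)|$ for every $S$ that is $\mathcal F$-isomorphic to $R\phi$) extends to a morphism $N_\phi\to P$ in $\mathcal F$, where $N_\phi$ is the group of all $x\in N_P(R)$ for which there is $y\in N_P(R\phi)$ with $(x^{-1}gx)\phi=y^{-1}(g\phi)y$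 for all $g\in R$. For a normal subgroup $Q$ of $P$, the factor system $\mathcal F/Q$ is the fusion system on $P/Q$ in which, for $Q\le R,S\le P$, the morphisms $R/Q\to S/Q$ are the maps induced by those $\phi\in\operatorname{Hom}_{\mathcal F}(R,S)$ with $Q\phi=Q$. **Theorem.** Let $\mathcal F$ be a fusion system on a finite $p$-group $P$, let $Q$ be a strongly $\mathcal F$-closed subgroup of $P$ (in particular $Q$ is normal in $P$), and let $R$ be a subgroup of $P$. 1. The map $S\mapsto S/Q$ is a bijection from the set of weakly $\mathcal F$-closed subgroups $S$ of $P$ containing $Q$ to the set of weakly $\mathcal F/Q$-closed subgroups of $P/Q$. 2. If $R$ is weakly $\mathcal F$-closed, then its image $RQ/Q$ in $P/Q$ is weakly $\mathcal F/Q$-closed. 3. If $\mathcal F$ is saturated, then the map $S\mapsto S/Q$ is a bijection from the set of strongly $\mathcal F$-closed subgroups $S$ of $P$ containing $Q$ to the set of strongly $\mathcal F/Q$-closed subgroups of $P/Q$. 4. If $\mathcal F$ is saturated and $R$ is strongly $\mathcal F$-closed, then its image $RQ/Q$ in $P/Q$ is strongly $\mathcal F/Q$-closed. -/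

import Mathlib

/-- A fusion system on a group `P` (in the application: a finite `p`-group).  Its objects are the
subgroups of `P`, and `Hom Q R` is its set of morphisms `Q → R`, which are injective group
homomorphisms. -/
structure FusionSystem (P : Type*) [Group P] where
  /-- The morphisms from `Q` to `R`. -/
  Hom : ∀ Q R : Subgroup P, Set (Q →* R)
  injective : ∀ {Q R : Subgroup P} {φ : Q →* R}, φ ∈ Hom Q R → Function.Injective φ
  comp_mem : ∀ {Q R S : Subgroup P} {φ : Q →* R} {ψ : R →* S},
    φ ∈ Hom Q R → ψ ∈ Hom R S → ψ.comp φ ∈ Hom Q S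
  /-- Every conjugation map `Q → R`, `x ↦ g⁻¹ x g`, with `g ∈ P` and `Q ^ g ≤ R`, is a morphism. -/
  conj_mem : ∀ {Q R : Subgroup P} (g : P) (θ : Q →* R),
    (∀ x : Q, (θ x : P) = g⁻¹ * x * g) → θ ∈ Hom Q R
  /-- For every morphism `φ : Q → R`, the isomorphism `Q → φ(Q)` is a morphism. -/
  rangeRestrict_mem : ∀ {Q R : Subgroup P} {φ : Q →* R}, φ ∈ Hom Q R →
    (R.subtype.comp φ).rangeRestrict ∈ Hom Q (R.subtype.comp φ).range
  /-- The inverse of a morphism that is an isomorphism of groups is a morphism. -/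
  symm_mem : ∀ {Q R : Subgroup P} (e : Q ≃* R),
    e.toMonoidHom ∈ Hom Q R → e.symm.toMonoidHom ∈ Hom R Q

namespace FusionSystem

/-- The image `φ(Q)`, as a subgroup of `P`, of a homomorphism `φ : Q → R` of subgroups of `P`. -/
def image {P : Type*} [Group P] {Q R : Subgroup P} (φ : Q →* R) : Subgroup P :=
  (R.subtype.comp φ).range

/-- `Q` and `R` are isomorphic in `F`. -/
def IsIsomorphic {P : Type*} [Group P] (F : FusionSystem P) (Q R : Subgroup P) : Prop :=
  ∃ e : Q ≃* R, e.toMonoidHom ∈ F.Hom Q R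

/-- `Q` is weakly `F`-closed: it is `F`-isomorphic only to itself. -/
def WeaklyClosed {P : Type*} [Group P] (F : FusionSystem P) (Q : Subgroup P) : Prop :=
  ∀ R : Subgroup P, F.IsIsomorphic Q R → R = Q

/-- `Q` is strongly `F`-closed: every `F`-morphism whose domain is a subgroup of `Q` has its image
inside `Q`. -/
def StronglyClosed {P : Type*} [Group P] (F : FusionSystem P) (Q : Subgroup P) : Prop :=
  ∀ (R S : Subgroup P) (φ : R →* S), R ≤ Q → φ ∈ F.Hom R S → image φ ≤ Q

/-- `Q` is fully normalized in `F`. -/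
def FullyNormalized {P : Type*} [Group P] (F : FusionSystem P) (Q : Subgroup P) : Prop :=
  ∀ R : Subgroup P, F.IsIsomorphic Q R →
    Nat.card (Subgroup.normalizer (R : Set P)) ≤ Nat.card (Subgroup.normalizer (Q : Set P))

/-- The group `Aut_F(Q)`. -/
def autGroup {P : Type*} [Group P] (F : FusionSystem P) (Q : Subgroup P) :
    Subgroup (MulAut Q) where
  carrier := {e | e.toMonoidHom ∈ F.Hom Q Q}
  mul_mem' := fun {a b} ha hb => F.comp_mem (φ := b.toMonoidHom) (ψ := a.toMonoidHom) hb ha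
  one_mem' := F.conj_mem 1 _ (fun x => by
    change (x : P) = _
    simp)
  inv_mem' := fun {a} ha => F.symm_mem a ha

/-- For `φ : Q → P`, the group `N_φ` of all `x ∈ N_P(Q)` such that, for some `y ∈ N_P(φ(Q))`,
one has `φ(x⁻¹ g x) = y⁻¹ φ(g) y` for all `g ∈ Q`. -/
def extender {P : Type*} [Group P] {Q : Subgroup P} (φ : Q →* (⊤ : Subgroup P)) :
    Subgroup P where
  carrier := {x | x ∈ Subgroup.normalizer (Q : Set P) ∧
    ∃ y ∈ Subgroup.normalizer (image φ : Set P),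
      ∀ g h : Q, (h : P) = x⁻¹ * g * x → (φ h : P) = y⁻¹ * φ g * y}
  one_mem' := ⟨one_mem _, 1, one_mem _, fun g h hgh => by
    have : h = g := Subtype.ext (by simpa using hgh)
    simp [this]⟩
  mul_mem' := by
    rintro a b ⟨ha, y, hy, hya⟩ ⟨hb, z, hz, hzb⟩
    refine ⟨mul_mem ha hb, y * z, mul_mem hy hz, fun g h hgh => ?_⟩
    have hk : a⁻¹ * (g : P) * a ∈ Q := by
      have := (Subgroup.mem_normalizer_iff.1 (inv_mem ha) (g : P)).1 g.2
      simpa using this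
    have h1 := hya g ⟨_, hk⟩ rfl
    have h2 := hzb ⟨_, hk⟩ h (by rw [hgh]; group)
    rw [h2, h1]
    group
  inv_mem' := by
    rintro a ⟨ha, y, hy, hya⟩
    refine ⟨inv_mem ha, y⁻¹, inv_mem hy, fun g h hgh => ?_⟩
    have h1 := hya h g (by rw [hgh]; group)
    rw [h1]
    group

theorem le_extender {P : Type*} [Group P] {Q : Subgroup P} (φ : Q →* (⊤ : Subgroup P)) :
    Q ≤ extender φ := by
  intro x hx
  refine ⟨Subgroup.le_normalizer hx, (φ ⟨x, hx⟩ : P),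
    Subgroup.le_normalizer ⟨⟨x, hx⟩, rfl⟩, fun g h hgh => ?_⟩
  have : h = (⟨x, hx⟩ : Q)⁻¹ * g * ⟨x, hx⟩ := Subtype.ext hgh
  rw [this]
  simp

/-- `F` is saturated: `Aut_P(P)` is a Sylow `p`-subgroup of `Aut_F(P)`, and every `F`-morphism
`φ : Q → P` with fully normalized image extends to an `F`-morphism `N_φ → P`. -/
def Saturated {P : Type*} [Group P] (p : ℕ) (F : FusionSystem P) : Prop :=
  (∃ T : Sylow p (F.autGroup ⊤), (T : Subgroup (F.autGroup ⊤)) =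
    (MulAut.conj (G := (⊤ : Subgroup P))).range.subgroupOf (F.autGroup ⊤)) ∧
  ∀ (Q : Subgroup P) (φ : Q →* (⊤ : Subgroup P)), φ ∈ F.Hom Q ⊤ → F.FullyNormalized (image φ) →
    ∃ ψ ∈ F.Hom (extender φ) ⊤, ψ.comp (Subgroup.inclusion (le_extender φ)) = φ

/-- A strongly `F`-closed subgroup is normal. -/
theorem StronglyClosed.normal {P : Type*} [Group P] {F : FusionSystem P} {Q : Subgroup P}
    (hQ : F.StronglyClosed Q) : Q.Normal := by
  refine ⟨fun n hn g => ?_⟩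
  let θ : Q →* (⊤ : Subgroup P) :=
    ((MulAut.conj g).toMonoidHom.comp Q.subtype).codRestrict ⊤ (fun _ => trivial)
  have hθ : θ ∈ F.Hom Q ⊤ := F.conj_mem g⁻¹ θ (fun x => by simp [θ])
  exact hQ Q ⊤ θ le_rfl hθ ⟨⟨n, hn⟩, by simp [θ]⟩

/-- Membership of a map in a fusion system does not depend on the chosen codomain. -/
theorem mem_of_eq {P : Type*} [Group P] (F : FusionSystem P) {Q R S : Subgroup P}
    {φ : Q →* R} (hφ : φ ∈ F.Hom Q R) (ψ : Q →* S) (h : ∀ x : Q, (ψ x : P) = φ x) :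
    ψ ∈ F.Hom Q S := by
  have hle : (R.subtype.comp φ).range ≤ S := by
    rintro _ ⟨x, rfl⟩
    change ((φ x : R) : P) ∈ S
    rw [← h x]
    exact (ψ x).2
  have h1 : Subgroup.inclusion hle ∈ F.Hom _ S := F.conj_mem 1 _ (fun x => by simp)
  have h2 := F.comp_mem (F.rangeRestrict_mem hφ) h1
  convert h2 using 1
  ext x
  exact h x

/-- `φ : R → S` induces `φ' : R/Q → S/Q`, where `A = R/Q`, `B = S/Q`, so that `R` and `S` are the
preimages of `A` and `B` in `P`, and `φ` satisfies `φ(Q) = Q`. -/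
def Induces {P : Type*} [Group P] (Q : Subgroup P) [Q.Normal] {A B : Subgroup (P ⧸ Q)}
    (φ : A.comap (QuotientGroup.mk' Q) →* B.comap (QuotientGroup.mk' Q)) (φ' : A →* B) : Prop :=
  Subgroup.map ((B.comap (QuotientGroup.mk' Q)).subtype.comp φ)
      (Q.subgroupOf (A.comap (QuotientGroup.mk' Q))) = Q ∧
    ∀ x : A.comap (QuotientGroup.mk' Q),
      (φ' ⟨QuotientGroup.mk' Q x, x.2⟩ : P ⧸ Q) = QuotientGroup.mk' Q (φ x)

theorem map_eq_iff {P : Type*} [Group P] {Q R S : Subgroup P} (φ : R →* S) :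
    Subgroup.map (S.subtype.comp φ) (Q.subgroupOf R) = Q ↔
      (∀ x : R, (x : P) ∈ Q → (φ x : P) ∈ Q) ∧
        ∀ q ∈ Q, ∃ x : R, (x : P) ∈ Q ∧ (φ x : P) = q := by
  constructor
  · intro h
    refine ⟨fun x hx => ?_, fun q hq => ?_⟩
    · rw [← h]
      exact ⟨x, hx, rfl⟩
    · rw [← h] at hq
      obtain ⟨x, hx, rfl⟩ := hq
      exact ⟨x, hx, rfl⟩
  · rintro ⟨h1, h2⟩
    apply le_antisymm
    · rintro _ ⟨x, hx, rfl⟩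
      exact h1 x hx
    · intro q hq
      obtain ⟨x, hx, rfl⟩ := h2 q hq
      exact ⟨x, hx, rfl⟩

theorem le_comap_mk' {P : Type*} [Group P] {Q : Subgroup P} [Q.Normal] (A : Subgroup (P ⧸ Q)) :
    Q ≤ A.comap (QuotientGroup.mk' Q) := by
  intro q hq
  have h : QuotientGroup.mk' Q q = 1 := (QuotientGroup.eq_one_iff q).2 hq
  rw [Subgroup.mem_comap, h]
  exact one_mem _

/-- The factor system `F/Q` on `P/Q`: its morphisms `R/Q → S/Q` are the maps induced by the
`F`-morphisms `φ : R → S` with `φ(Q) = Q`. -/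
def factor {P : Type*} [Group P] (F : FusionSystem P) (Q : Subgroup P) [Q.Normal] :
    FusionSystem (P ⧸ Q) where
  Hom A B := {φ' | ∃ φ ∈ F.Hom (A.comap (QuotientGroup.mk' Q)) (B.comap (QuotientGroup.mk' Q)),
    Induces Q φ φ'}
  injective := by
    rintro A B φ' ⟨φ, hφ, hQ, h⟩
    rw [map_eq_iff] at hQ
    rw [injective_iff_map_eq_one]
    rintro ⟨a, ha⟩ h1
    obtain ⟨x, rfl⟩ := QuotientGroup.mk'_surjective Q a
    have h2 := h ⟨x, ha⟩
    rw [h1] at h2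
    have h3 : (φ ⟨x, ha⟩ : P) ∈ Q := (QuotientGroup.eq_one_iff _).1 h2.symm
    obtain ⟨y, hy, hyx⟩ := hQ.2 _ h3
    have h4 := F.injective hφ (Subtype.ext hyx)
    apply Subtype.ext
    apply (QuotientGroup.eq_one_iff x).2
    simpa [h4] using hy
  comp_mem := by
    rintro A B C φ' ψ' ⟨φ, hφ, hQ, h⟩ ⟨ψ, hψ, hQ', h'⟩
    rw [map_eq_iff] at hQ hQ'
    refine ⟨ψ.comp φ, F.comp_mem hφ hψ, ?_, fun x => ?_⟩
    · rw [map_eq_iff]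
      refine ⟨fun x hx => hQ'.1 _ (hQ.1 x hx), fun q hq => ?_⟩
      obtain ⟨y, hy, rfl⟩ := hQ'.2 q hq
      obtain ⟨x, hx, hxy⟩ := hQ.2 _ hy
      exact ⟨x, hx, by rw [← Subtype.ext hxy]; rfl⟩
    · rw [MonoidHom.comp_apply, MonoidHom.comp_apply, ← h' (φ x)]
      congr 2
      exact Subtype.ext (h x)
  conj_mem := by
    intro A B g' θ' hθ'
    obtain ⟨g, rfl⟩ := QuotientGroup.mk'_surjective Q g'
    let θ : A.comap (QuotientGroup.mk' Q) →* B.comap (QuotientGroup.mk' Q) :=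
      ((MulAut.conj g⁻¹).toMonoidHom.comp (Subgroup.subtype _)).codRestrict _ (fun x => by
        have h := hθ' ⟨QuotientGroup.mk' Q x, x.2⟩
        have h2 := (θ' ⟨QuotientGroup.mk' Q x, x.2⟩).2
        rw [h] at h2
        simpa using h2)
    have hθ : ∀ x, (θ x : P) = g⁻¹ * x * g := fun x => by simp [θ]
    refine ⟨θ, F.conj_mem g θ hθ, ?_, fun x => ?_⟩
    · rw [map_eq_iff]
      refine ⟨fun x hx => ?_, fun q hq => ?_⟩
      · rw [hθ]
        simpa using (inferInstance : Q.Normal).conj_mem _ hx g⁻¹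
      · have h1 : g * q * g⁻¹ ∈ Q := (inferInstance : Q.Normal).conj_mem _ hq g
        refine ⟨⟨g * q * g⁻¹, ?_⟩, h1, ?_⟩
        · exact le_comap_mk' A h1
        · rw [hθ]
          group
    · rw [hθ', hθ]
      simp
  rangeRestrict_mem := by
    rintro A B φ' ⟨φ, hφ, hQ, h⟩
    let ψ : A.comap (QuotientGroup.mk' Q) →*
        ((B.subtype.comp φ').range).comap (QuotientGroup.mk' Q) :=
      ((Subgroup.subtype _).comp φ).codRestrict _ (fun x => ⟨_, h x⟩)
    have hψ : ∀ x, (ψ x : P) = φ x := fun x => rfl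
    refine ⟨ψ, F.mem_of_eq hφ ψ hψ, ?_, fun x => h x⟩
    rw [map_eq_iff] at hQ ⊢
    exact hQ
  symm_mem := by
    rintro A B e ⟨φ, hφ, hQ, h⟩
    have hQ' := (map_eq_iff φ).1 hQ
    have hs : Function.Surjective φ := by
      rintro ⟨y, hy⟩
      obtain ⟨⟨a, ha⟩, hae⟩ := e.surjective ⟨QuotientGroup.mk' Q y, hy⟩
      obtain ⟨x, rfl⟩ := QuotientGroup.mk'_surjective Q a
      have h1 : QuotientGroup.mk' Q y = QuotientGroup.mk' Q (φ ⟨x, ha⟩) := by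
        rw [← h ⟨x, ha⟩]
        exact (congrArg Subtype.val hae).symm
      obtain ⟨z, hz, hzy⟩ := hQ'.2 _ (QuotientGroup.eq.1 h1.symm)
      refine ⟨⟨x, ha⟩ * z, Subtype.ext ?_⟩
      rw [map_mul, Subgroup.coe_mul, hzy]
      group
    let d := MulEquiv.ofBijective φ ⟨F.injective hφ, hs⟩
    have hd : ∀ x, d x = φ x := fun x => rfl
    refine ⟨d.symm.toMonoidHom, F.symm_mem d hφ, ?_, fun x => ?_⟩
    · rw [map_eq_iff]
      refine ⟨fun x hx => ?_, fun q hq => ?_⟩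
      · obtain ⟨y, hy, hyx⟩ := hQ'.2 _ hx
        have : d.symm x = y := by
          rw [MulEquiv.symm_apply_eq]
          exact (Subtype.ext hyx).symm
        change ((d.symm x : _) : P) ∈ Q
        rw [this]
        exact hy
      · have hqA : q ∈ A.comap (QuotientGroup.mk' Q) := le_comap_mk' A hq
        refine ⟨d ⟨q, hqA⟩, hQ'.1 _ hq, ?_⟩
        exact congrArg Subtype.val (d.symm_apply_apply ⟨q, hqA⟩)
    · obtain ⟨y, rfl⟩ := d.surjective x
      have h1 : (⟨QuotientGroup.mk' Q (d y), (d y).2⟩ : B) =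
          e ⟨QuotientGroup.mk' Q y, y.2⟩ := Subtype.ext (h y).symm
      change ((e.symm _ : A) : P ⧸ Q) = QuotientGroup.mk' Q (d.symm (d y))
      rw [h1, e.symm_apply_apply, d.symm_apply_apply]

end FusionSystem

/-! As Q is strongly closed, a morphism whose domain contains Q maps Q onto Q and descends to P/Q;
this settles weak closure. Images of closed subgroups are handled by restriction to R. The hard
point is that the preimage S of a strongly closed subgroup of P/Q is strongly closed: morphisms on a
subgroup U not containing Q induce nothing on P/Q. Here saturation and downward induction on |U|
enter (`Saturated.respects_of_forall_le`). With V fully normalized and isomorphic to U, a morphism φ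
on U factors through isomorphisms onto V that extend to the normalizers of U and φ(U), and an
automorphism α of V. For α, pick x in Q normalizing V but outside V. A Frattini argument gives an
automorphism k of V, trivial modulo Q, such that kα extends to a subgroup containing x; since k
moves elements only by Q ≤ S, α respects S because kα does (`Saturated.aut_respects`). All this
needs Aut_P(V) to be Sylow in Aut_F(V), which saturation grants outright only for V = P
(`Saturated.exists_sylow_eq_conjAut`). -/

namespace Sylow

/-! ### Two facts on p-subgroups of finite groups. -/

/-- A form of the Frattini argument: a `p`-subgroup of a normal subgroup `K` can be conjugated into
a given Sylow subgroup by an element of `K`. -/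
theorem exists_conj_mem_of_le_normal {G : Type*} [Group G] [Finite G] {p : ℕ} [Fact p.Prime]
    (T : Sylow p G) (K : Subgroup G) [K.Normal] {X : Subgroup G} (hX : IsPGroup p X)
    (hXK : X ≤ K) : ∃ k ∈ K, ∀ x ∈ X, k * x * k⁻¹ ∈ T := by
  obtain ⟨Y, hY⟩ := (hX.comap_subtype (K := K)).exists_le_sylow
  obtain ⟨T', hT'⟩ := (Y.2.map K.subtype).exists_le_sylow
  obtain ⟨g, hg⟩ := MulAction.exists_smul_eq G T' T
  -- Since G = K N_G(Y), write g = kn; as n normalizes Y ≥ X, the factor k alone already moves X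
  -- into T.
  have htop : g ∈ K ⊔ Subgroup.normalizer ((Y.map K.subtype : Subgroup G) : Set G) := by
    rw [sup_comm, Y.normalizer_sup_eq_top]
    trivial
  obtain ⟨k, hk, n, hn, rfl⟩ := Subgroup.mem_sup_of_normal_left.1 htop
  refine ⟨k, hk, fun x hx => ?_⟩
  have hxY : x ∈ Y.map K.subtype := ⟨⟨x, hXK hx⟩, hY hx, rfl⟩
  have h1 := (Subgroup.mem_normalizer_iff.1 (inv_mem hn) x).1 hxY
  rw [← hg, ← SetLike.mem_coe, Sylow.coe_smul]
  refine ⟨_, hT' h1, ?_⟩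
  simp [mul_assoc]

end Sylow

theorem IsPGroup.exists_mem_normalizer_notMem {G : Type*} [Group G] [Finite G] {p : ℕ}
    [Fact p.Prime] {H K : Subgroup G} (hK : IsPGroup p K) (h : H < K) :
    ∃ x ∈ K, x ∈ Subgroup.normalizer (H : Set G) ∧ x ∉ H := by
  have := hK.isNilpotent
  have h1 : H.subgroupOf K < ⊤ := by
    rw [lt_top_iff_ne_top, Ne, Subgroup.subgroupOf_eq_top]
    exact h.not_ge
  obtain ⟨x, hx, hxH⟩ := SetLike.exists_of_lt (Group.normalizerCondition_of_isNilpotent _ h1)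
  refine ⟨x, x.2, ?_, hxH⟩
  rw [Subgroup.mem_normalizer_iff] at hx ⊢
  intro y
  -- The normalizer inside K tests only elements of K; for y outside K neither y nor its conjugate
  -- lies in H.
  by_cases hy : y ∈ K
  · exact hx ⟨y, hy⟩
  · refine ⟨fun hyH => (hy (h.le hyH)).elim, fun hyH => (hy ?_).elim⟩
    have := mul_mem (mul_mem (inv_mem x.2) (h.le hyH)) x.2
    simpa [mul_assoc] using this

/-! ### Elementary operations on morphisms. -/

namespace FusionSystem

section

variable {P : Type*} [Group P] {F : FusionSystem P}

theorem restrict_mem {U U' R : Subgroup P} {φ : U →* R} (hφ : φ ∈ F.Hom U R) (h : U' ≤ U) :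
    φ.comp (Subgroup.inclusion h) ∈ F.Hom U' R :=
  F.comp_mem (F.conj_mem 1 _ (fun x => by simp)) hφ

theorem trans_mem {U V W : Subgroup P} {e : U ≃* V} {f : V ≃* W}
    (he : e.toMonoidHom ∈ F.Hom U V) (hf : f.toMonoidHom ∈ F.Hom V W) :
    (e.trans f).toMonoidHom ∈ F.Hom U W :=
  F.comp_mem he hf

theorem IsIsomorphic.refl (U : Subgroup P) : F.IsIsomorphic U U :=
  ⟨MulEquiv.refl U, F.conj_mem 1 _ (fun x => by simp)⟩

theorem IsIsomorphic.symm {U V : Subgroup P} (h : F.IsIsomorphic U V) : F.IsIsomorphic V U :=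
  let ⟨e, he⟩ := h
  ⟨e.symm, F.symm_mem e he⟩

theorem IsIsomorphic.trans {U V W : Subgroup P} (h : F.IsIsomorphic U V)
    (h' : F.IsIsomorphic V W) : F.IsIsomorphic U W :=
  let ⟨_, he⟩ := h
  let ⟨_, hf⟩ := h'
  ⟨_, trans_mem he hf⟩

theorem IsIsomorphic.card_eq {U V : Subgroup P} (h : F.IsIsomorphic U V) :
    Nat.card U = Nat.card V :=
  let ⟨e, _⟩ := h
  Nat.card_congr e.toEquiv

/-- A morphism restricts to an isomorphism from any subgroup of its domain onto the image. -/
theorem exists_equiv {U R : Subgroup P} {φ : U →* R} (hφ : φ ∈ F.Hom U R) {U' V : Subgroup P}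
    (hU : U' ≤ U) (hV : ∀ y, y ∈ V ↔ ∃ x : U, (x : P) ∈ U' ∧ (φ x : P) = y) :
    ∃ e : U' ≃* V, e.toMonoidHom ∈ F.Hom U' V ∧
      ∀ x : U', (e x : P) = φ (Subgroup.inclusion hU x) := by
  let θ : U' →* V := ((R.subtype.comp φ).comp (Subgroup.inclusion hU)).codRestrict V
    (fun x => (hV _).2 ⟨Subgroup.inclusion hU x, x.2, rfl⟩)
  have hθ : θ ∈ F.Hom U' V := F.mem_of_eq (restrict_mem hφ hU) θ (fun _ => rfl)
  refine ⟨MulEquiv.ofBijective θ ⟨F.injective hθ, ?_⟩, hθ, fun _ => rfl⟩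
  rintro ⟨y, hy⟩
  obtain ⟨x, hx, rfl⟩ := (hV y).1 hy
  exact ⟨⟨x, hx⟩, rfl⟩

theorem exists_equiv_image {U R : Subgroup P} {φ : U →* R} (hφ : φ ∈ F.Hom U R) :
    ∃ e : U ≃* image φ, e.toMonoidHom ∈ F.Hom U (image φ) ∧ ∀ x : U, (e x : P) = φ x := by
  refine exists_equiv hφ le_rfl (fun y => ⟨?_, ?_⟩)
  · rintro ⟨x, rfl⟩
    exact ⟨x, x.2, rfl⟩
  · rintro ⟨x, _, rfl⟩
    exact ⟨x, rfl⟩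

/-- An isomorphism of `F`, regarded as a morphism to the whole group. -/
theorem subtype_comp_mem {U V : Subgroup P} {e : U ≃* V} (he : e.toMonoidHom ∈ F.Hom U V) :
    (Subgroup.inclusion le_top).comp e.toMonoidHom ∈ F.Hom U ⊤ :=
  F.comp_mem he (F.conj_mem 1 _ (fun x => by simp))

theorem image_subtype_comp {U V : Subgroup P} (e : U ≃* V) :
    image ((Subgroup.inclusion (le_top : V ≤ ⊤)).comp e.toMonoidHom) = V := by
  ext y
  constructor
  · rintro ⟨x, rfl⟩
    exact (e x).2
  · intro hy
    exact ⟨e.symm ⟨y, hy⟩, by simp⟩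

/-- Restricting φ to U ⊓ Q turns strong closure into a condition on single elements. -/
theorem StronglyClosed.apply_mem {Q : Subgroup P} (hQ : F.StronglyClosed Q) {U V : Subgroup P}
    {φ : U →* V} (hφ : φ ∈ F.Hom U V) (x : U) (hx : (x : P) ∈ Q) : (φ x : P) ∈ Q :=
  hQ _ _ _ inf_le_right (restrict_mem hφ (inf_le_left : U ⊓ Q ≤ U)) ⟨⟨x, x.2, hx⟩, rfl⟩

/-- A morphism that maps a finite subgroup `Q` of its domain into `Q` maps it onto `Q`. -/
theorem map_eq_of_forall_mem [Finite P] {Q U V : Subgroup P} {φ : U →* V} (hφ : φ ∈ F.Hom U V)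
    (hU : Q ≤ U) (h : ∀ x : U, (x : P) ∈ Q → (φ x : P) ∈ Q) :
    Subgroup.map (V.subtype.comp φ) (Q.subgroupOf U) = Q := by
  refine Subgroup.eq_of_le_of_card_ge ?_ ?_
  · rintro _ ⟨x, hx, rfl⟩
    exact h x hx
  · rw [Subgroup.card_map_of_injective
      ((Subtype.val_injective).comp (F.injective hφ) : Function.Injective (V.subtype.comp φ)),
      Nat.card_congr (Subgroup.subgroupOfEquivOfLe hU).toEquiv]

theorem exists_fullyNormalized [Finite P] (F : FusionSystem P) (U : Subgroup P) :
    ∃ V, F.IsIsomorphic U V ∧ F.FullyNormalized V := by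
  obtain ⟨V, hV, hmax⟩ := (Set.toFinite {V | F.IsIsomorphic U V}).exists_maximalFor
    (fun V : Subgroup P => Nat.card (Subgroup.normalizer (V : Set P))) _ ⟨U, IsIsomorphic.refl U⟩
  refine ⟨V, hV, fun R hR => ?_⟩
  by_contra h
  exact h (hmax (hV.trans hR) (not_le.1 h).le)

/-! ### The groups Aut_P(V) and the extension axiom. -/

/-- The group `Aut_P(V)`, as a subgroup of `Aut_F(V)`. -/
def conjAut (F : FusionSystem P) (V : Subgroup P) : Subgroup (F.autGroup V) :=
  V.normalizerMonoidHom.range.subgroupOf (F.autGroup V)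

theorem mem_conjAut {V : Subgroup P} {α : F.autGroup V} :
    α ∈ F.conjAut V ↔ ∃ y ∈ Subgroup.normalizer (V : Set P),
      ∀ v : V, ((α : MulAut V) v : P) = y * v * y⁻¹ := by
  constructor
  · rintro ⟨y, hy⟩
    refine ⟨y, y.2, fun v => ?_⟩
    change _ = (α : MulAut V) at hy
    rw [← hy]
    rfl
  · rintro ⟨y, hy, h⟩
    refine ⟨⟨y, hy⟩, ?_⟩
    ext v
    exact (h v).symm

theorem exists_mem_conjAut {V : Subgroup P} {y : P} (hy : y ∈ Subgroup.normalizer (V : Set P)) :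
    ∃ α ∈ F.conjAut V, ∀ v : V, ((α : MulAut V) v : P) = y * v * y⁻¹ := by
  have h : V.normalizerMonoidHom ⟨y, hy⟩ ∈ F.autGroup V :=
    F.conj_mem y⁻¹ _ (fun x => by simp)
  exact ⟨⟨_, h⟩, ⟨_, rfl⟩, fun _ => rfl⟩

theorem isPGroup_conjAut {p : ℕ} (hP : IsPGroup p P) (F : FusionSystem P) (V : Subgroup P) :
    IsPGroup p (F.conjAut V) := by
  have h : IsPGroup p V.normalizerMonoidHom.range :=
    (hP.to_subgroup _).of_surjective _ V.normalizerMonoidHom.rangeRestrict_surjective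
  exact h.comap_subtype

/-- Conjugation by an isomorphism `U → V` of `F` maps `Aut_F(U)` to `Aut_F(V)`. -/
def autConj {U V : Subgroup P} (e : U ≃* V) (he : e.toMonoidHom ∈ F.Hom U V) :
    F.autGroup U →* F.autGroup V :=
  ((MulAut.congr e).toMonoidHom.comp (F.autGroup U).subtype).codRestrict _ (fun α =>
    trans_mem (F.symm_mem e he) (trans_mem α.2 he))

theorem autConj_apply {U V : Subgroup P} {e : U ≃* V} {he : e.toMonoidHom ∈ F.Hom U V}
    (α : F.autGroup U) (v : V) :
    (autConj e he α : MulAut V) v = e ((α : MulAut U) (e.symm v)) := rfl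

/-- The extension axiom: if `V` is fully normalized, an isomorphism `e : U → V` extends to a
subgroup `N` that contains every `x ∈ N_P(U)` whose conjugation action is carried into `Aut_P(V)`
by `e`. -/
theorem Saturated.exists_extension {p : ℕ} (hF : F.Saturated p) {U V : Subgroup P} {e : U ≃* V}
    (he : e.toMonoidHom ∈ F.Hom U V) (hV : F.FullyNormalized V) :
    ∃ (N : Subgroup P) (ψ : N →* (⊤ : Subgroup P)) (hN : U ≤ N), ψ ∈ F.Hom N ⊤ ∧
      (∀ u : U, (ψ (Subgroup.inclusion hN u) : P) = e u) ∧
      ∀ x ∈ Subgroup.normalizer (U : Set P), ∀ α : F.autGroup U,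
        (∀ u : U, ((α : MulAut U) u : P) = x * u * x⁻¹) → autConj e he α ∈ F.conjAut V → x ∈ N := by
  obtain ⟨ψ, hψ, hext⟩ := hF.2 U _ (subtype_comp_mem he) (by rwa [image_subtype_comp])
  refine ⟨_, ψ, le_extender _, hψ, fun u => ?_, fun x hx α hα hmem => ?_⟩
  · exact congrArg Subtype.val (DFunLike.congr_fun hext u)
  · obtain ⟨y, hy, hα'⟩ := mem_conjAut.1 hmem
    refine ⟨hx, y, by rwa [image_subtype_comp], fun g h hgh => ?_⟩
    change (e h : P) = y⁻¹ * e g * y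
    have h1 : g = (α : MulAut U) h := by
      apply Subtype.ext
      rw [hα, hgh]
      group
    have h2 := hα' (e h)
    rw [autConj_apply, e.symm_apply_apply, ← h1] at h2
    rw [h2]
    group

/-- If `Aut_P(V)` is a Sylow subgroup of `Aut_F(V)`, a `p`-group of automorphisms of `U` is carried
into `Aut_P(V)` by some isomorphism `U → V`. -/
theorem exists_autConj_mem [Finite P] {p : ℕ} [Fact p.Prime] {U V : Subgroup P}
    (hUV : F.IsIsomorphic U V) (T : Sylow p (F.autGroup V))
    (hT : (T : Subgroup (F.autGroup V)) = F.conjAut V) {X : Subgroup (F.autGroup U)}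
    (hX : IsPGroup p X) :
    ∃ (e : U ≃* V) (he : e.toMonoidHom ∈ F.Hom U V), ∀ α ∈ X, autConj e he α ∈ F.conjAut V := by
  obtain ⟨e, he⟩ := hUV
  obtain ⟨T', hT'⟩ := (hX.map (autConj e he)).exists_le_sylow
  obtain ⟨g, hg⟩ := MulAction.exists_smul_eq (F.autGroup V) T' T
  -- Following e by g conjugates the image of X from T' into T.
  refine ⟨e.trans (g : MulAut V), trans_mem he g.2, fun α hα => ?_⟩
  rw [← hT, ← hg, Sylow.coe_subgroup_smul]
  exact ⟨_, hT' ⟨α, hα, rfl⟩, rfl⟩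

theorem card_lt_card_of_notMem [Finite P] {U N : Subgroup P} (h : U ≤ N) {x : P} (hx : x ∈ N)
    (hxU : x ∉ U) : Nat.card U < Nat.card N := by
  refine lt_of_le_of_ne (Subgroup.card_le_of_le h) (fun hc => hxU ?_)
  rwa [Subgroup.eq_of_le_of_card_ge h hc.ge]

theorem card_lt_card_normalizer [Finite P] {p : ℕ} [Fact p.Prime] (hP : IsPGroup p P)
    {U : Subgroup P} (hU : U ≠ ⊤) :
    Nat.card U < Nat.card (Subgroup.normalizer (U : Set P)) := by
  obtain ⟨x, _, hx, hxU⟩ :=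
    (hP.to_subgroup ⊤).exists_mem_normalizer_notMem (lt_top_iff_ne_top.2 hU)
  exact card_lt_card_of_notMem Subgroup.le_normalizer hx hxU

theorem conjAut_top (F : FusionSystem P) : F.conjAut ⊤ =
    (MulAut.conj (G := (⊤ : Subgroup P))).range.subgroupOf (F.autGroup ⊤) := by
  ext α
  rw [mem_conjAut]
  constructor
  · rintro ⟨y, _, h⟩
    refine ⟨⟨y, trivial⟩, ?_⟩
    ext v
    exact (h v).symm
  · rintro ⟨y, hy⟩
    refine ⟨y, Subgroup.le_normalizer y.2, fun v => ?_⟩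
    change _ = (α : MulAut (⊤ : Subgroup P)) at hy
    rw [← hy]
    rfl

/-! ### The Sylow property at fully normalized subgroups. -/

/-- An automorphism of a fully normalized subgroup `V` that normalizes `Aut_P(V)` extends to
`N_P(V)`. -/
theorem Saturated.exists_extension_normalizer [Finite P] {p : ℕ} (hF : F.Saturated p)
    {V : Subgroup P} (hV : F.FullyNormalized V) {α : F.autGroup V}
    (hα : α ∈ Subgroup.normalizer (F.conjAut V : Set (F.autGroup V))) :
    ∃ β : F.autGroup (Subgroup.normalizer (V : Set P)), ∀ v : V,
      (β.1 (Subgroup.inclusion Subgroup.le_normalizer v) : P) =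
        (α : MulAut V) v := by
  obtain ⟨N, ψ, hN, hψ, hext, hall⟩ := hF.exists_extension (e := (α : MulAut V)) α.2 hV
  have hM : Subgroup.normalizer (V : Set P) ≤ N := by
    intro y hy
    obtain ⟨γ, hγ, hγy⟩ := exists_mem_conjAut (F := F) hy
    exact hall y hy γ hγy ((Subgroup.mem_normalizer_iff.1 hα γ).1 hγ)
  -- If x normalizes V, then ψ(x) normalizes ψ(V) = α(V) = V; so ψ restricts to an automorphism of
  -- N_P(V).
  have hconj : ∀ x : N, (x : P) ∈ Subgroup.normalizer (V : Set P) → ∀ v ∈ V,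
      (ψ x : P) * v * (ψ x : P)⁻¹ ∈ V := by
    intro x hx v hv
    obtain ⟨w, hw⟩ := (α : MulAut V).surjective ⟨v, hv⟩
    have h1 : v = ψ (Subgroup.inclusion hN w) := by rw [hext, hw]
    have h2 : (x : P) * w * (x : P)⁻¹ ∈ V := (Subgroup.mem_normalizer_iff.1 hx _).1 w.2
    have h3 := hext ⟨_, h2⟩
    have h4 : Subgroup.inclusion hN ⟨_, h2⟩ = x * Subgroup.inclusion hN w * x⁻¹ := rfl
    rw [h4] at h3
    rw [h1]
    simp only [map_mul, map_inv, Subgroup.coe_mul, Subgroup.coe_inv] at h3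
    rw [h3]
    exact Subtype.prop _
  have hmap := map_eq_of_forall_mem hψ hM (fun x hx => by
    rw [Subgroup.mem_normalizer_iff]
    refine fun v => ⟨hconj x hx v, fun hv => ?_⟩
    have := hconj x⁻¹ (inv_mem hx) _ hv
    simpa [mul_assoc] using this)
  rw [map_eq_iff] at hmap
  obtain ⟨ε, hε, hεx⟩ := exists_equiv hψ hM
    (fun y => ⟨hmap.2 y, fun ⟨x, hx, hxy⟩ => hxy ▸ hmap.1 x hx⟩)
  exact ⟨⟨ε, hε⟩, fun v => (hεx _).trans (hext v)⟩

/-- If `V` is a fully normalized subgroup and `Aut_P(N)` is a Sylow subgroup of `Aut_F(N)` for some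
`N` isomorphic to `N_P(V)`, then every `p`-element of `Aut_F(V)` that extends to a `p`-element of
`Aut_F(N_P(V))` lies in `Aut_P(V)`. -/
theorem FullyNormalized.mem_conjAut_of_extends [Finite P] {p : ℕ} [Fact p.Prime] {V N : Subgroup P}
    (hV : F.FullyNormalized V) (hN : F.IsIsomorphic (Subgroup.normalizer (V : Set P)) N)
    (T : Sylow p (F.autGroup N)) (hT : (T : Subgroup (F.autGroup N)) = F.conjAut N)
    {α : F.autGroup V} {β : F.autGroup (Subgroup.normalizer (V : Set P))}
    (hβ : IsPGroup p (Subgroup.zpowers β))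
    (h : ∀ v : V, (β.1 (Subgroup.inclusion Subgroup.le_normalizer v) : P) =
        (α : MulAut V) v) : α ∈ F.conjAut V := by
  obtain ⟨e, he, heX⟩ := exists_autConj_mem hN T hT hβ
  obtain ⟨y, -, hy⟩ := mem_conjAut.1 (heX β (Subgroup.mem_zpowers β))
  let i : V →* Subgroup.normalizer (V : Set P) := Subgroup.inclusion Subgroup.le_normalizer
  have hi : ∀ v, β.1 (i v) = i ((α : MulAut V) v) := fun v => Subtype.ext (h v)
  let V' : Subgroup P := (N.subtype.comp (e.toMonoidHom.comp i)).range
  have hmem : ∀ v, (e (i v) : P) ∈ V' := fun v => ⟨v, rfl⟩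
  have hiso : F.IsIsomorphic V V' := by
    obtain ⟨f, hf, -⟩ := exists_equiv_image (restrict_mem he (Subgroup.le_normalizer (H := V)))
    exact ⟨f, hf⟩
  have hle : N ≤ Subgroup.normalizer (V' : Set P) := by
    have key : ∀ n ∈ N, ∀ v ∈ V', n * v * n⁻¹ ∈ V' := by
      rintro n hn _ ⟨v, rfl⟩
      obtain ⟨x, hx⟩ := e.surjective ⟨n, hn⟩
      obtain rfl : (e x : P) = n := congrArg Subtype.val hx
      refine ⟨⟨x * v * (x : P)⁻¹, (Subgroup.mem_normalizer_iff.1 x.2 _).1 v.2⟩, ?_⟩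
      have : i ⟨x * v * (x : P)⁻¹, (Subgroup.mem_normalizer_iff.1 x.2 _).1 v.2⟩ =
        x * i v * x⁻¹ := rfl
      simp [this]
    intro n hn
    rw [Subgroup.mem_normalizer_iff]
    refine fun v => ⟨key n hn v, fun hv => ?_⟩
    have := key _ (inv_mem hn) _ hv
    simpa [mul_assoc] using this
  -- Full normalization of V bounds |N_P(V')| by |N_P(V)| = |N|.
  have hNV : N = Subgroup.normalizer (V' : Set P) :=
    Subgroup.eq_of_le_of_card_ge hle ((hV V' hiso).trans hN.card_eq.le)
  have hyi : ∀ v, (e (i ((α : MulAut V) v)) : P) = y * e (i v) * y⁻¹ := fun v => by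
    rw [← hy, autConj_apply, e.symm_apply_apply, hi]
  -- β stabilizes V, so y, which induces its transport along e, normalizes V' = e(V). Hence y = e(x)
  -- with x in N_P(V), and α is conjugation by x.
  have hyN : y ∈ N := by
    rw [hNV, Subgroup.mem_normalizer_iff]
    refine fun n => ⟨?_, ?_⟩
    · rintro ⟨v, rfl⟩
      exact ⟨(α : MulAut V) v, hyi v⟩
    · rintro ⟨v, hv⟩
      obtain ⟨w, rfl⟩ := (α : MulAut V).surjective v
      have h1 := (hyi w).symm.trans hv
      exact ⟨w, by simpa using h1⟩
  obtain ⟨x, hx⟩ := e.surjective ⟨y, hyN⟩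
  obtain rfl : (e x : P) = y := congrArg Subtype.val hx
  refine mem_conjAut.2 ⟨x, x.2, fun v => ?_⟩
  have h1 : e (i ((α : MulAut V) v)) = e (x * i v * x⁻¹) := by
    apply Subtype.ext
    rw [hyi]
    simp
  exact congrArg Subtype.val (e.injective h1)

/-- In a saturated fusion system, `Aut_P(V)` is a Sylow subgroup of `Aut_F(V)` for every fully
normalized subgroup `V`. -/
theorem Saturated.exists_sylow_eq_conjAut [Finite P] {p : ℕ} [Fact p.Prime] (hP : IsPGroup p P)
    (hF : F.Saturated p) {V : Subgroup P} (hV : F.FullyNormalized V) :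
    ∃ T : Sylow p (F.autGroup V), (T : Subgroup (F.autGroup V)) = F.conjAut V := by
  induction hn : Nat.card P - Nat.card V using Nat.strong_induction_on generalizing V with
  | _ n ih =>
  by_cases htop : V = ⊤
  · subst htop
    rw [conjAut_top]
    exact hF.1
  obtain ⟨T, hT⟩ := (isPGroup_conjAut hP F V).exists_le_sylow
  refine ⟨T, ?_⟩
  by_contra hne
  -- Normalizers grow in the p-group T, so a proper Aut_P(V) would be normalized by some α in T
  -- outside it.
  obtain ⟨α, hαT, hα, hα'⟩ :=
    T.2.exists_mem_normalizer_notMem (lt_of_le_of_ne hT (Ne.symm hne))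
  obtain ⟨β, hβ⟩ := hF.exists_extension_normalizer hV hα
  obtain ⟨N, hN, hNF⟩ := F.exists_fullyNormalized (Subgroup.normalizer (V : Set P))
  have hlt := card_lt_card_normalizer hP htop
  have hle : Nat.card (Subgroup.normalizer (V : Set P)) ≤ Nat.card P := Subgroup.card_le_card_group _
  obtain ⟨T', hT'⟩ := ih _ (by rw [← hn, ← hN.card_eq]; omega) hNF rfl
  have hpow : ∀ (k : ℕ) (v : V),
      ((β ^ k).1 (Subgroup.inclusion Subgroup.le_normalizer v) : P) =
        (α ^ k).1 v := by
    intro k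
    induction k with
    | zero => exact fun _ => rfl
    | succ k ihk =>
      intro v
      have h1 : β.1 (Subgroup.inclusion Subgroup.le_normalizer v) =
        Subgroup.inclusion Subgroup.le_normalizer ((α : MulAut V) v) := Subtype.ext (hβ v)
      rw [pow_succ, pow_succ]
      simp only [Subgroup.coe_mul, MulAut.mul_apply]
      rw [h1, ihk]
  have hβ0 : orderOf β ≠ 0 := (orderOf_pos β).ne'
  -- The extension β need not be a p-element; raising it to the p'-part of its order makes it one.
  -- This exponent is prime to the p-power order of α, so α is recovered from that power.
  have hm := hV.mem_conjAut_of_extends (α := α ^ (ordCompl[p] (orderOf β)))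
    (β := β ^ (ordCompl[p] (orderOf β))) hN T' hT' (by
      apply IsPGroup.of_card (n := (orderOf β).factorization p)
      rw [Nat.card_zpowers, orderOf_pow_of_dvd (Nat.ordCompl_pos p hβ0).ne'
        (Nat.ordCompl_dvd _ p)]
      exact Nat.div_div_self (Nat.ordProj_dvd _ p) hβ0) (hpow _)
  have hco : (ordCompl[p] (orderOf β)).Coprime (orderOf α) := by
    obtain ⟨k, hk⟩ := T.2.exists_orderOf_eq_pow ⟨α, hαT⟩
    rw [Subgroup.orderOf_mk] at hk
    rw [hk]
    exact ((Nat.coprime_ordCompl Fact.out hβ0).pow_left k).symm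
  obtain ⟨k, hk⟩ := exists_pow_eq_self_of_coprime hco
  exact hα' (hk ▸ pow_mem hm k)

/-! ### Passage to the factor system. -/

/-- Every morphism between preimages of subgroups of `P/Q` that maps `Q` onto itself induces a
morphism of the factor system. -/
theorem exists_induces {Q : Subgroup P} [Q.Normal] {A B : Subgroup (P ⧸ Q)}
    (φ : A.comap (QuotientGroup.mk' Q) →* B.comap (QuotientGroup.mk' Q))
    (h : Subgroup.map ((B.comap (QuotientGroup.mk' Q)).subtype.comp φ)
      (Q.subgroupOf (A.comap (QuotientGroup.mk' Q))) = Q) :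
    ∃ φ' : A →* B, Induces Q φ φ' := by
  have hs := (QuotientGroup.mk' Q).subgroupComap_surjective_of_surjective A
    (QuotientGroup.mk'_surjective Q)
  refine ⟨MonoidHom.liftOfSurjective _ hs
    ⟨((QuotientGroup.mk' Q).subgroupComap B).comp φ, fun x hx => ?_⟩, h, fun x => ?_⟩
  · have hx' : (x : P) ∈ Q := (QuotientGroup.eq_one_iff _).1 (congrArg Subtype.val hx)
    exact Subtype.ext ((QuotientGroup.eq_one_iff _).2 (((map_eq_iff φ).1 h).1 x hx'))
  · exact congrArg Subtype.val (MonoidHom.liftOfRightInverse_comp_apply _ _ _ _ x)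

theorem bijOn_map_mk' (Q : Subgroup P) [Q.Normal] {p : Subgroup P → Prop}
    {q : Subgroup (P ⧸ Q) → Prop} (h : ∀ A, p (A.comap (QuotientGroup.mk' Q)) ↔ q A) :
    Set.BijOn (Subgroup.map (QuotientGroup.mk' Q)) {R | Q ≤ R ∧ p R} {A | q A} := by
  have hc : ∀ R : Subgroup P, Q ≤ R →
      (R.map (QuotientGroup.mk' Q)).comap (QuotientGroup.mk' Q) = R := fun R hR => by
    rw [Subgroup.comap_map_eq_self]
    rwa [QuotientGroup.ker_mk']
  refine ⟨fun R hR => ?_, fun R hR S hS hRS => ?_, fun A hA => ?_⟩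
  · exact (h _).1 ((hc R hR.1).symm ▸ hR.2)
  · rw [← hc R hR.1, ← hc S hS.1]
    exact congrArg _ hRS
  · exact ⟨_, ⟨le_comap_mk' A, (h A).2 hA⟩,
      Subgroup.map_comap_eq_self_of_surjective (QuotientGroup.mk'_surjective Q) A⟩

/-- A morphism inducing an isomorphism from RQ/Q is defined on RQ, and its restriction to R has
image R. -/
theorem WeaklyClosed.map_mk' {Q : Subgroup P} [Q.Normal] {R : Subgroup P}
    (hR : F.WeaklyClosed R) : (F.factor Q).WeaklyClosed (R.map (QuotientGroup.mk' Q)) := by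
  rintro B ⟨e, φ, hφ, -, h⟩
  have hle : R ≤ (R.map (QuotientGroup.mk' Q)).comap (QuotientGroup.mk' Q) :=
    Subgroup.le_comap_map _ _
  have hφR := restrict_mem hφ hle
  obtain ⟨f, hf, -⟩ := exists_equiv_image hφR
  have hRR := hR _ ⟨f, hf⟩
  ext b
  constructor
  · intro hb
    obtain ⟨⟨_, r, hr, rfl⟩, har⟩ := e.surjective ⟨b, hb⟩
    refine ⟨φ ⟨r, hle hr⟩, ?_, ?_⟩
    · exact hRR.le ⟨⟨r, hr⟩, rfl⟩
    · exact (h ⟨r, hle hr⟩).symm.trans (congrArg Subtype.val har)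
  · rintro ⟨r, hr, rfl⟩
    rw [SetLike.mem_coe, ← hRR] at hr
    obtain ⟨r', rfl⟩ := hr
    exact (φ (Subgroup.inclusion hle r')).2

theorem StronglyClosed.map_mk' {Q : Subgroup P} [Q.Normal] {R : Subgroup P}
    (hR : F.StronglyClosed R) : (F.factor Q).StronglyClosed (R.map (QuotientGroup.mk' Q)) := by
  rintro A B φ' hA ⟨φ, hφ, -, h⟩ _ ⟨⟨a, ha⟩, rfl⟩
  obtain ⟨r, hr, rfl⟩ := hA ha
  exact ⟨_, hR.apply_mem hφ ⟨r, ha⟩ hr, (h ⟨r, ha⟩).symm⟩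

/-- For the converse, an isomorphism e from the preimage of A onto T maps Q onto Q, so T contains Q
and e descends to an isomorphism of F/Q. -/
theorem weaklyClosed_comap_mk'_iff [Finite P] {Q : Subgroup P} [Q.Normal]
    (hQ : F.StronglyClosed Q) (A : Subgroup (P ⧸ Q)) :
    F.WeaklyClosed (A.comap (QuotientGroup.mk' Q)) ↔ (F.factor Q).WeaklyClosed A := by
  have hmc := Subgroup.map_comap_eq_self_of_surjective (QuotientGroup.mk'_surjective Q)
  refine ⟨fun h => hmc A ▸ h.map_mk', ?_⟩
  rintro hA T ⟨e, he⟩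
  have hmap := map_eq_of_forall_mem he (le_comap_mk' A) (hQ.apply_mem he)
  have hQT : Q ≤ T := by
    intro q hq
    obtain ⟨x, -, rfl⟩ := ((map_eq_iff _).1 hmap).2 q hq
    exact Subtype.prop _
  obtain ⟨B, rfl⟩ : ∃ B : Subgroup (P ⧸ Q), B.comap (QuotientGroup.mk' Q) = T :=
    ⟨T.map (QuotientGroup.mk' Q), by
      rw [Subgroup.comap_map_eq_self]
      rwa [QuotientGroup.ker_mk']⟩
  obtain ⟨φ', hφ'⟩ := exists_induces e.toMonoidHom hmap
  have hmem : φ' ∈ (F.factor Q).Hom A B := ⟨_, he, hφ'⟩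
  have hsurj : Function.Surjective φ' := by
    rintro ⟨b, hb⟩
    obtain ⟨t, rfl⟩ := QuotientGroup.mk'_surjective Q b
    obtain ⟨x, hx⟩ := e.surjective ⟨t, hb⟩
    refine ⟨⟨_, x.2⟩, Subtype.ext ((hφ'.2 x).trans ?_)⟩
    exact congrArg (fun z => QuotientGroup.mk' Q (Subtype.val z)) hx
  rw [hA B ⟨MulEquiv.ofBijective φ' ⟨(F.factor Q).injective hmem, hsurj⟩, hmem⟩]

/-! ### Strong closure of preimages. -/

/-- The morphisms defined on `U` preserve membership in `S`. -/
def Respects (F : FusionSystem P) (S U : Subgroup P) : Prop :=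
  ∀ φ ∈ F.Hom U ⊤, ∀ u : U, (φ u : P) ∈ S ↔ (u : P) ∈ S

/-- The restriction of φ to U ⊓ S, with S the preimage of A, descends to a morphism defined on a
subgroup of A. The reverse implication applies this to the inverse of φ, whose domain φ(U) again
contains Q. -/
theorem respects_comap_mk'_of_le [Finite P] {Q : Subgroup P} [Q.Normal]
    (hQ : F.StronglyClosed Q) {A : Subgroup (P ⧸ Q)} (hA : (F.factor Q).StronglyClosed A)
    {U : Subgroup P} (hU : Q ≤ U) : F.Respects (A.comap (QuotientGroup.mk' Q)) U := by
  have key : ∀ {U V : Subgroup P} {φ : U →* V}, Q ≤ U → φ ∈ F.Hom U V → ∀ u : U,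
      (u : P) ∈ A.comap (QuotientGroup.mk' Q) → (φ u : P) ∈ A.comap (QuotientGroup.mk' Q) := by
    intro U V φ hU hφ u hu
    let C : Subgroup (P ⧸ Q) := U.map (QuotientGroup.mk' Q) ⊓ A
    have hCU : C.comap (QuotientGroup.mk' Q) ≤ U := by
      rw [Subgroup.comap_inf, Subgroup.comap_map_eq_self (by rwa [QuotientGroup.ker_mk'])]
      exact inf_le_left
    let θ : C.comap (QuotientGroup.mk' Q) →*
        (⊤ : Subgroup (P ⧸ Q)).comap (QuotientGroup.mk' Q) :=
      ((V.subtype.comp φ).comp (Subgroup.inclusion hCU)).codRestrict _ (fun _ => trivial)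
    have hθ : θ ∈ F.Hom _ _ := F.mem_of_eq (restrict_mem hφ hCU) θ (fun _ => rfl)
    obtain ⟨θ', hθ'⟩ := exists_induces θ
      (map_eq_of_forall_mem hθ (le_comap_mk' C) (hQ.apply_mem hθ))
    have huC : (u : P) ∈ C.comap (QuotientGroup.mk' Q) := ⟨⟨u, u.2, rfl⟩, hu⟩
    exact hA _ _ θ' inf_le_right ⟨θ, hθ, hθ'⟩ ⟨⟨_, huC⟩, hθ'.2 ⟨u, huC⟩⟩
  refine fun φ hφ u => ⟨fun h => ?_, key hU hφ u⟩
  obtain ⟨e, he, hex⟩ := exists_equiv_image hφ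
  have hQ' : Q ≤ image φ := by
    intro q hq
    obtain ⟨x, -, hx⟩ :=
      ((map_eq_iff φ).1 (map_eq_of_forall_mem hφ hU (hQ.apply_mem hφ))).2 q hq
    exact ⟨x, hx⟩
  have := key hQ' (F.symm_mem e he) (e u) (by rwa [hex])
  simpa using this

/-- If all morphisms on subgroups larger than `V` respect `S ≥ Q`, so do the automorphisms of the
fully normalized subgroup `V`, provided that `V` does not contain `Q`. -/
theorem Saturated.aut_respects [Finite P] {p : ℕ} [Fact p.Prime] (hP : IsPGroup p P)
    (hF : F.Saturated p) {Q S V : Subgroup P} (hQ : F.StronglyClosed Q) (hQS : Q ≤ S)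
    (hV : F.FullyNormalized V) (hQV : ¬ Q ≤ V)
    (ih : ∀ N : Subgroup P, Nat.card V < Nat.card N → F.Respects S N) (α : F.autGroup V) (v : V) :
    ((α : MulAut V) v : P) ∈ S ↔ (v : P) ∈ S := by
  have := hQ.normal
  -- K consists of the automorphisms acting trivially modulo Q; strong closure of Q makes it normal.
  let K : Subgroup (F.autGroup V) :=
    { carrier := {κ | ∀ v : V, ((κ : MulAut V) v : P) * (v : P)⁻¹ ∈ Q}
      one_mem' := fun v => by simp
      mul_mem' := fun {a b} ha hb v => by
        have := mul_mem (ha ((b : MulAut V) v)) (hb v)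
        simpa [mul_assoc] using this
      inv_mem' := fun {a} ha v => by
        have := inv_mem (ha ((a : MulAut V)⁻¹ v))
        simpa using this }
  have hK : K.Normal := by
    refine ⟨fun κ hκ γ v => ?_⟩
    have h1 := hQ.apply_mem γ.2 ((κ : MulAut V) ((γ : MulAut V)⁻¹ v) * ((γ : MulAut V)⁻¹ v)⁻¹)
      (hκ _)
    simpa using h1
  obtain ⟨T, hT⟩ := hF.exists_sylow_eq_conjAut hP hV
  -- Normalizers grow in VQ; the V-factor of a new normalizing element can be dropped.
  obtain ⟨x, hxQ, hx, hxV⟩ : ∃ x ∈ Q, x ∈ Subgroup.normalizer (V : Set P) ∧ x ∉ V := by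
    have hlt : V < V ⊔ Q := lt_of_le_of_ne le_sup_left (fun h => hQV (sup_eq_left.1 h.symm))
    obtain ⟨y, hy, hyN, hyV⟩ := (hP.to_subgroup _).exists_mem_normalizer_notMem hlt
    obtain ⟨w, hw, x, hx, rfl⟩ := Subgroup.mem_sup_of_normal_right.1 hy
    refine ⟨x, hx, ?_, fun h => hyV (mul_mem hw h)⟩
    exact (Subgroup.mul_mem_cancel_left _ (Subgroup.le_normalizer hw)).1 hyN
  obtain ⟨δ, hδ, hδx⟩ := exists_mem_conjAut (F := F) hx
  have hδK : δ ∈ K := fun v => by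
    rw [hδx, mul_assoc, mul_assoc]
    refine mul_mem hxQ ?_
    rw [← mul_assoc]
    exact hQ.normal.conj_mem _ (inv_mem hxQ) _
  have hX : IsPGroup p ((Subgroup.zpowers δ).map (MulAut.conj α).toMonoidHom) :=
    ((isPGroup_conjAut hP F V).to_le ((Subgroup.zpowers_le).2 hδ)).map _
  -- The α-conjugate of conjugation by x stays in K, so an element k of K moves it into Aut_P(V).
  -- This is the condition for x to lie in the domain to which kα extends.
  obtain ⟨k, hk, hkX⟩ := T.exists_conj_mem_of_le_normal K hX (by
    rw [Subgroup.map_le_iff_le_comap, Subgroup.zpowers_le]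
    exact hK.conj_mem δ hδK α)
  have hkδ := hkX _ ⟨δ, Subgroup.mem_zpowers δ, rfl⟩
  rw [← SetLike.mem_coe, ← Sylow.coe_coe, hT] at hkδ
  obtain ⟨N, ψ, hN, hψ, hext, hall⟩ :=
    hF.exists_extension (e := ((k * α : F.autGroup V) : MulAut V)) (k * α).2 hV
  have hxN : x ∈ N := by
    exact hall x hx δ hδx hkδ
  have h1 := ih N (card_lt_card_of_notMem hN hxN hxV) ψ hψ (Subgroup.inclusion hN v)
  rw [hext] at h1
  have h2 := hQS (hk ((α : MulAut V) v))
  have h3 := Subgroup.mul_mem_cancel_left _ h2 (y := ((α : MulAut V) v : P))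
  rw [inv_mul_cancel_right] at h3
  exact h3.symm.trans h1

/-- Aut_P(U) is a p-group, so e can be chosen to carry it into Aut_P(V); such an e extends to
N_P(U), which is larger than U. -/
theorem Saturated.exists_equiv_respects [Finite P] {p : ℕ} [Fact p.Prime] (hP : IsPGroup p P)
    (hF : F.Saturated p) {S U V : Subgroup P} (hUV : F.IsIsomorphic U V)
    (hV : F.FullyNormalized V) (hU : U ≠ ⊤)
    (ih : ∀ N : Subgroup P, Nat.card U < Nat.card N → F.Respects S N) :
    ∃ e : U ≃* V, e.toMonoidHom ∈ F.Hom U V ∧ ∀ u : U, (e u : P) ∈ S ↔ (u : P) ∈ S := by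
  obtain ⟨T, hT⟩ := hF.exists_sylow_eq_conjAut hP hV
  obtain ⟨e, he, hX⟩ := exists_autConj_mem hUV T hT (isPGroup_conjAut hP F U)
  obtain ⟨N, ψ, hN, hψ, hext, hall⟩ := hF.exists_extension he hV
  have hle : Subgroup.normalizer (U : Set P) ≤ N := by
    intro x hx
    obtain ⟨γ, hγ, hγx⟩ := exists_mem_conjAut (F := F) hx
    exact hall x hx γ hγx (hX γ hγ)
  have hlt := (card_lt_card_normalizer hP hU).trans_le (Subgroup.card_le_of_le hle)
  refine ⟨e, he, fun u => ?_⟩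
  rw [← hext]
  exact ih N hlt ψ hψ _

theorem Saturated.respects_of_forall_le [Finite P] {p : ℕ} [Fact p.Prime] (hP : IsPGroup p P)
    (hF : F.Saturated p) {Q S : Subgroup P} (hQ : F.StronglyClosed Q) (hQS : Q ≤ S)
    (h : ∀ U, Q ≤ U → F.Respects S U) (U : Subgroup P) : F.Respects S U := by
  induction hn : Nat.card P - Nat.card U using Nat.strong_induction_on generalizing U with
  | _ n ih =>
  by_cases hQU : Q ≤ U
  · exact h U hQU
  have ih' : ∀ N : Subgroup P, Nat.card U < Nat.card N → F.Respects S N := fun N hN => by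
    have := Subgroup.card_le_card_group N
    exact ih _ (by omega) N rfl
  have htop : ∀ W : Subgroup P, Nat.card U = Nat.card W → W ≠ ⊤ := by
    rintro W hW rfl
    exact hQU ((Subgroup.eq_top_of_card_eq U (by simpa using hW)).symm ▸ le_top)
  intro φ hφ u
  obtain ⟨f, hf, hfx⟩ := exists_equiv_image hφ
  have hiso : F.IsIsomorphic U (image φ) := ⟨f, hf⟩
  obtain ⟨V, hV, hVF⟩ := F.exists_fullyNormalized U
  obtain ⟨e₁, he₁, h₁⟩ := hF.exists_equiv_respects hP hV hVF (htop U rfl) ih'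
  obtain ⟨e₂, he₂, h₂⟩ := hF.exists_equiv_respects hP (hiso.symm.trans hV) hVF
    (htop _ hiso.card_eq) (hiso.card_eq ▸ ih')
  -- An isomorphism V → U would map Q onto itself and force Q ≤ U.
  have hQV : ¬ Q ≤ V := by
    intro hQV
    obtain ⟨g, hg⟩ := hV.symm
    have hm := (map_eq_iff _).1 (map_eq_of_forall_mem hg hQV (hQ.apply_mem hg))
    refine hQU (fun q hq => ?_)
    obtain ⟨x, -, rfl⟩ := hm.2 q hq
    exact Subtype.prop _
  -- The automorphism is e₂ ∘ φ ∘ e₁⁻¹; since e₁ and e₂ respect S in both directions, so does φ.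
  have hα := hF.aut_respects hP hQ hQS hVF hQV (hV.card_eq ▸ ih')
    ⟨(e₁.symm.trans f).trans e₂, trans_mem (trans_mem (F.symm_mem e₁ he₁) hf) he₂⟩ (e₁ u)
  simp only [MulEquiv.trans_apply, MulEquiv.symm_apply_apply] at hα
  rw [← hfx, ← h₂, ← h₁ u]
  exact hα

theorem Saturated.stronglyClosed_comap_mk'_iff [Finite P] {p : ℕ} [Fact p.Prime]
    (hP : IsPGroup p P) (hF : F.Saturated p) {Q : Subgroup P} [Q.Normal]
    (hQ : F.StronglyClosed Q) (A : Subgroup (P ⧸ Q)) :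
    F.StronglyClosed (A.comap (QuotientGroup.mk' Q)) ↔ (F.factor Q).StronglyClosed A := by
  have hmc := Subgroup.map_comap_eq_self_of_surjective (QuotientGroup.mk'_surjective Q)
  refine ⟨fun h => hmc A ▸ h.map_mk', ?_⟩
  rintro hA R S φ hR hφ _ ⟨x, rfl⟩
  have hr := hF.respects_of_forall_le hP hQ (le_comap_mk' A)
    (fun U hU => respects_comap_mk'_of_le hQ hA hU) R
  exact (hr _ (F.mem_of_eq hφ ((Subgroup.inclusion le_top).comp φ) (fun _ => rfl)) x).2 (hR x.2)

end

end FusionSystem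

theorem mainTheorem9 {P : Type*} [Group P] [Finite P] (p : ℕ) [Fact p.Prime] (hP : IsPGroup p P)
    (F : FusionSystem P) (Q : Subgroup P) (hQ : F.StronglyClosed Q) :
    haveI : Q.Normal := hQ.normal
    Set.BijOn (Subgroup.map (QuotientGroup.mk' Q))
        {R : Subgroup P | Q ≤ R ∧ F.WeaklyClosed R}
        {A : Subgroup (P ⧸ Q) | (F.factor Q).WeaklyClosed A} ∧
      (∀ R : Subgroup P, F.WeaklyClosed R →
        (F.factor Q).WeaklyClosed (R.map (QuotientGroup.mk' Q))) ∧
      (F.Saturated p →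
        Set.BijOn (Subgroup.map (QuotientGroup.mk' Q))
          {R : Subgroup P | Q ≤ R ∧ F.StronglyClosed R}
          {A : Subgroup (P ⧸ Q) | (F.factor Q).StronglyClosed A}) ∧
      (F.Saturated p → ∀ R : Subgroup P, F.StronglyClosed R →
        (F.factor Q).StronglyClosed (R.map (QuotientGroup.mk' Q))) := by
  have := hQ.normal
  exact ⟨FusionSystem.bijOn_map_mk' Q (FusionSystem.weaklyClosed_comap_mk'_iff hQ),
    fun R hR => hR.map_mk',
    fun hF => FusionSystem.bijOn_map_mk' Q (hF.stronglyClosed_comap_mk'_iff hP hQ),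
    fun _ R hR => hR.map_mk'⟩
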